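/- Let $S=\mathbb{C}[x,y,z]$, let $d\ge 3$, and let $C:f=0$ be a reduced curve of degree $d$ in the complex projective plane, with Jacobian ideal $J_f=(f_x,f_y,f_z)$, Milnor algebra $M(f)=S/J_f$ and module of Jacobian syzygies $$D_0(f)=\{(a,b,c)\in S^3 : af_x+bf_y+cf_z=0\}.$$ Suppose that $C$ is of type $(d,r,m)$, that is, $D_0(f)$ is minimally generated by $m$ homogeneous syzygies, all of the same degree $r$. Let $\tau(C)$ be the total Tjurina number of $C$, i.e. the degree of the ideal $J_f$, which is the value of $\dim_{\mathbb{C}} M(f)_k$ for all large $k$. Put $\Delta m=(2r-d+3)-m$, and assume that $m>3$ and $\Delta m=2$. Then $\tau(C)$ is well defined, and $M(f)$ has a minimal graded free resolution of the form $$0\to\bigoplus_{i=1}^{m-2}S(-e_i)\to S(1-d-r)^m\to S^3(1-d)\to S$$ with $e_1\le\dots\le e_{m-2}$, where the last map is $(a,b,c)\mapsto af_x+bf_y+cf_z$. For every such resolution, define integers $\epsilon_j$ by $e_j=d+r-1+\epsilon_j$ for $1\le j\le m-2$. Then exactly one of the following two cases holds: 1. $\epsilon_{m-2}=3$, $\epsilon_j=1$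 for $1\le j\le m-3$, and $\tau(C)=\dfrac{d(d-1)}{2}-3+r(d-r-2)$; 2. $\epsilon_{m-2}=\epsilon_{m-3}=2$, $\epsilon_j=1$ for $1\le j\le m-4$, and $\tau(C)=\dfrac{d(d-1)}{2}-2+r(d-r-2)$. -/

import Mathlib

/-- The polynomial ring `S = ℂ[x, y, z]` with its standard grading. -/
abbrev PolyS : Type := MvPolynomial (Fin 3) ℂ

/-- `f = 0` is a reduced curve of degree `d ≥ 3` in the complex projective plane. -/
structure IsReducedPlaneCurve (d : ℕ) (f : PolyS) : Prop where
  three_le : 3 ≤ d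
  isHomogeneous : f.IsHomogeneous d
  squarefree : Squarefree f

/-- The `S`-linear map `S³ → S`, `(a, b, c) ↦ a f_x + b f_y + c f_z`. -/
noncomputable def jacobianMap (f : PolyS) : (Fin 3 → PolyS) →ₗ[PolyS] PolyS :=
  Fintype.linearCombination PolyS (fun i => MvPolynomial.pderiv i f)

/-- The module `D₀(f)` of Jacobian syzygies of `f`. -/
noncomputable def jacobianSyzygies (f : PolyS) : Submodule PolyS (Fin 3 → PolyS) :=
  LinearMap.ker (jacobianMap f)

/-- The Jacobian ideal `J_f = (f_x, f_y, f_z)`. -/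
noncomputable def jacobianIdeal (f : PolyS) : Ideal PolyS :=
  Ideal.span (Set.range fun i : Fin 3 => MvPolynomial.pderiv i f)

/-- `ρ_1, …, ρ_m` is a minimal set of homogeneous generators of `D₀(f)`, with
`deg ρ_j = dd j` and the degrees in increasing order. -/
structure IsMinimalSyzygyGenerators (f : PolyS) {m : ℕ} (dd : Fin m → ℕ)
    (ρ : Fin m → Fin 3 → PolyS) : Prop where
  monotone : Monotone dd
  isHomogeneous : ∀ j i, (ρ j i).IsHomogeneous (dd j)
  span_eq : Submodule.span PolyS (Set.range ρ) = jacobianSyzygies f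
  minimal : ∀ j, Submodule.span PolyS (ρ '' {j}ᶜ) ≠ jacobianSyzygies f

/-- `C : f = 0` is a curve of type `(d, r, m)`: a reduced plane curve of degree `d` such that
`D₀(f)` is minimally generated by `m` homogeneous syzygies, all of the same degree `r`. -/
def IsCurveOfType (d r m : ℕ) (f : PolyS) : Prop :=
  IsReducedPlaneCurve d f ∧
    ∃ ρ : Fin m → Fin 3 → PolyS, IsMinimalSyzygyGenerators f (fun _ => r) ρ

/-- `Δm = m(d,r)_max - m`, where `m(d,r)_max = 2r - d + 3`. -/
def deltaM (d r m : ℕ) : ℤ := (2 * (r : ℤ) - d + 3) - m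

/-- The matrices `ρ` and `σ` give a minimal graded free resolution of the Milnor algebra
`M(f) = S / J_f`, of the form
`0 → ⨁_{i=1}^{m-2} S(-e_i) → ⨁_{j=1}^m S(1-d-d_j) → S³(1-d) → S`,
where `e_1 ≤ … ≤ e_{m-2}` and `d_1 ≤ … ≤ d_m`, and where the last map is `jacobianMap f`.
The generator of `S(1-d-d_j)` goes to `ρ j`, and that of `S(-e_i)` goes to `σ i`. -/
structure IsMinimalMilnorResolution (f : PolyS) (d : ℕ) {m : ℕ}
    (dd : Fin m → ℕ) (e : Fin (m - 2) → ℕ)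
    (ρ : Fin m → Fin 3 → PolyS) (σ : Fin (m - 2) → Fin m → PolyS) : Prop where
  monotone_dd : Monotone dd
  monotone_e : Monotone e
  /-- the middle map is homogeneous of degree zero -/
  homogeneous_ρ : ∀ j i, (ρ j i).IsHomogeneous (dd j)
  /-- the left map is homogeneous of degree zero: the entry `σ i j` is homogeneous of degree
  `e_i - (d - 1) - d_j`, and it is zero if that number is negative -/
  homogeneous_σ : ∀ i j, σ i j = 0 ∨
    ∃ n : ℕ, (n : ℤ) = (e i : ℤ) - ((d : ℤ) - 1) - (dd j : ℤ) ∧ (σ i j).IsHomogeneous n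
  injective : Function.Injective (Fintype.linearCombination PolyS σ)
  exact_middle : Function.Exact (Fintype.linearCombination PolyS σ)
    (Fintype.linearCombination PolyS ρ)
  exact_right : Function.Exact (Fintype.linearCombination PolyS ρ) (jacobianMap f)
  /-- minimality: all entries of the three matrices lie in the ideal `(x, y, z)` -/
  minimal_f : ∀ i, MvPolynomial.constantCoeff (MvPolynomial.pderiv i f) = 0
  minimal_ρ : ∀ j i, MvPolynomial.constantCoeff (ρ j i) = 0
  minimal_σ : ∀ i j, MvPolynomial.constantCoeff (σ i j) = 0

/-- The integers `ε_j`, `1 ≤ j ≤ m - 2`, defined by `e_j = d + d_{j+2} - 1 + ε_j`.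
The element `j` of `Fin (m - 2)` stands for the index `j + 1`. -/
def resolutionEpsilon (d : ℕ) {m : ℕ} (dd : Fin m → ℕ) (e : Fin (m - 2) → ℕ)
    (j : Fin (m - 2)) : ℤ :=
  (e j : ℤ) - ((d : ℤ) + (dd ⟨(j : ℕ) + 2, by omega⟩ : ℤ) - 1)

/-- `dim_ℂ (S / I)_k`, the Hilbert function of `S / I` at `k`, where `(S / I)_k` is the image
in `S / I` of the space of homogeneous polynomials of degree `k`. -/
noncomputable def hilbertFunction (I : Ideal PolyS) (k : ℕ) : ℕ :=
  Module.finrank ℂ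
    ((MvPolynomial.homogeneousSubmodule (Fin 3) ℂ k).map (Ideal.Quotient.mkₐ ℂ I).toLinearMap)

/-- The total Tjurina number of `C : f = 0` is `τ`. It is the degree of the Jacobian ideal `J_f`,
that is, the degree of the (zero-dimensional or empty) subscheme of the projective plane which
`J_f` defines: the Hilbert polynomial of `S / J_f` is the constant `τ`. -/
def HasTotalTjurinaNumber (f : PolyS) (τ : ℕ) : Prop :=
  ∀ᶠ k in Filter.atTop, hilbertFunction (jacobianIdeal f) k = τ

/-! Write e_i = d - 1 + r + n_i, so that ε_i = n_i. Minimality of the resolution forces n_i ≥ 1. In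
large degrees k the Hilbert function of M(f) is the alternating sum of the dimensions of the graded
pieces of the resolution. The ranks 1, 3, m, m - 2 have alternating sum zero, so this is αk + β with
α = (d - 1) - 2r + ∑ n_i. Since f is squarefree, J_f contains two coprime forms of degree d - 1,
which bounds the Hilbert function by (d - 1)² (`hilbertFunction_jacobianIdeal_le`). Hence α = 0, and
τ(C) = β depends only on d, r, ∑ n_i and ∑ n_i² (`IsMinimalMilnorResolution.degrees`).

The condition Δm = 2 now reads ∑ n_i = m = (m - 2) + 2. A nondecreasing sequence of m - 2 positive
integers with this sum is (1, …, 1, 3) or (1, …, 1, 2, 2) (`monotone_sum_eq_add_two`). The sums of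
squares m + 6 and m + 4 give the two values of τ(C).

A resolution exists because the relations among the generators of D₀(f) form a free module. This
case of Hilbert's syzygy theorem is proved by hand with the Koszul complex of x, y, z
(`linearIndependent_of_third_syzygy`). Its rank is m - 2 because D₀(f) has rank 2. -/

open MvPolynomial

-- Graded pieces and homogeneous matrices.

attribute [local instance] MvPolynomial.gradedAlgebra in
theorem decompose_homogeneousSubmodule_apply (p : PolyS) (n : ℕ) :
    (DirectSum.decompose (homogeneousSubmodule (Fin 3) ℂ) p n : PolyS) =
      homogeneousComponent n p :=
  decomposition.decompose'_apply p n

attribute [local instance] MvPolynomial.gradedAlgebra in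
/-- The homogeneous component of a product one of whose factors is homogeneous. -/
theorem homogeneousComponent_mul_of_isHomogeneous {p q : PolyS} {n b : ℕ}
    (hq : q.IsHomogeneous n) :
    homogeneousComponent b (p * q) =
      if n ≤ b then homogeneousComponent (b - n) p * q else 0 := by
  have h := DirectSum.coe_decompose_mul_of_right_mem
    (homogeneousSubmodule (Fin 3) ℂ) (a := p) b (i := n)
    ((mem_homogeneousSubmodule n q).2 hq)
  simp only [decompose_homogeneousSubmodule_apply] at h
  exact h

/-- The space of vectors of polynomials whose `i`-th entry is homogeneous of degree `a i`. -/
noncomputable def gradedPiece {ι : Type*} (a : ι → ℕ) : Submodule ℂ (ι → PolyS) :=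
  Submodule.pi Set.univ fun i => homogeneousSubmodule (Fin 3) ℂ (a i)

theorem mem_gradedPiece {ι : Type*} {a : ι → ℕ} {v : ι → PolyS} :
    v ∈ gradedPiece a ↔ ∀ i, (v i).IsHomogeneous (a i) := by
  simp [gradedPiece, Submodule.mem_pi]

/-- The projection of a vector of polynomials to `gradedPiece a`. -/
noncomputable def gradedProj {ι : Type*} (a : ι → ℕ) (v : ι → PolyS) : ι → PolyS :=
  fun i => homogeneousComponent (a i) (v i)

theorem gradedProj_mem {ι : Type*} (a : ι → ℕ) (v : ι → PolyS) :
    gradedProj a v ∈ gradedPiece a :=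
  mem_gradedPiece.2 fun _ => homogeneousComponent_isHomogeneous _ _

theorem gradedProj_eq_self {ι : Type*} {a : ι → ℕ} {v : ι → PolyS} (hv : v ∈ gradedPiece a) :
    gradedProj a v = v :=
  funext fun i => homogeneousComponent_eq_self (mem_gradedPiece.1 hv i)

theorem homogeneousComponent_linearCombination {ι : Type*} [Fintype ι] {a : ι → ℕ} {b : ℕ}
    {c : ι → PolyS} (hc : ∀ i, c i = 0 ∨ ∃ n, a i + n = b ∧ (c i).IsHomogeneous n)
    (v : ι → PolyS) :
    homogeneousComponent b (Fintype.linearCombination PolyS c v) =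
      Fintype.linearCombination PolyS c (gradedProj a v) := by
  simp only [Fintype.linearCombination_apply, map_sum, smul_eq_mul]
  refine Finset.sum_congr rfl fun i _ => ?_
  rcases hc i with h | ⟨n, hn, h⟩
  · simp [h]
  · rw [homogeneousComponent_mul_of_isHomogeneous h, if_pos (by omega),
      show b - n = a i by omega, gradedProj]

/-- A matrix of polynomials is homogeneous from degrees `a` to degrees `b`. -/
def IsHomogeneousMatrix {ι κ : Type*} (a : ι → ℕ) (b : κ → ℕ) (A : ι → κ → PolyS) : Prop :=
  ∀ i j, A i j = 0 ∨ ∃ n, a i + n = b j ∧ (A i j).IsHomogeneous n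

theorem linearCombination_apply_coord {ι κ : Type*} [Fintype ι] (A : ι → κ → PolyS)
    (v : ι → PolyS) (j : κ) :
    Fintype.linearCombination PolyS A v j =
      Fintype.linearCombination PolyS (fun i => A i j) v := by
  simp [Fintype.linearCombination_apply, Finset.sum_apply]

/-- Compatibility with projections is what turns exactness over S into exactness in each degree: a
preimage of a homogeneous vector may be replaced by its projection. -/
theorem gradedProj_linearCombination {ι κ : Type*} [Fintype ι] {a : ι → ℕ} {b : κ → ℕ}
    {A : ι → κ → PolyS} (hA : IsHomogeneousMatrix a b A) (v : ι → PolyS) :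
    gradedProj b (Fintype.linearCombination PolyS A v) =
      Fintype.linearCombination PolyS A (gradedProj a v) := by
  funext j
  rw [gradedProj, linearCombination_apply_coord, linearCombination_apply_coord,
    homogeneousComponent_linearCombination fun i => hA i j]

/-! ### Dimension counts in exact sequences of graded modules. -/

theorem finrank_homogeneousSubmodule (k : ℕ) :
    Module.finrank ℂ (homogeneousSubmodule (Fin 3) ℂ k) = (k + 2).choose 2 := by
  have hs : {d : Fin 3 →₀ ℕ | d.degree = k} =
      ((Finset.univ.finsuppAntidiag k : Finset (Fin 3 →₀ ℕ)) : Set (Fin 3 →₀ ℕ)) := by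
    ext d
    simp [Finset.mem_finsuppAntidiag, Finsupp.degree_eq_sum]
  rw [homogeneousSubmodule_eq_finsupp_supported, hs]
  rw [LinearEquiv.finrank_eq (AddMonoidAlgebra.supportedEquivFinsupp _)]
  simp only [Module.finrank_finsupp_self, Finset.coe_sort_coe, Fintype.card_coe]
  rw [Finset.card_finsuppAntidiag_nat_eq_choose, Finset.card_univ, Fintype.card_fin]
  rw [show 3 + k - 1 = k + 2 by omega, ← Nat.choose_symm_add]

instance finite_homogeneousSubmodule (k : ℕ) :
    Module.Finite ℂ (homogeneousSubmodule (Fin 3) ℂ k) :=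
  Module.finite_of_finrank_pos <| by
    rw [finrank_homogeneousSubmodule]; exact Nat.choose_pos (by omega)

/-- A graded piece is the product of the spaces of homogeneous polynomials. -/
noncomputable def gradedPieceEquiv {ι : Type*} (a : ι → ℕ) :
    gradedPiece a ≃ₗ[ℂ] (∀ i, homogeneousSubmodule (Fin 3) ℂ (a i)) where
  toFun v i := ⟨v.1 i, mem_gradedPiece.1 v.2 i⟩
  invFun w := ⟨fun i => (w i).1, mem_gradedPiece.2 fun i => (w i).2⟩
  map_add' _ _ := rfl
  map_smul' _ _ := rfl

instance finite_gradedPiece {ι : Type*} [Finite ι] (a : ι → ℕ) :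
    Module.Finite ℂ (gradedPiece a) :=
  Module.Finite.equiv (gradedPieceEquiv a).symm

theorem finrank_gradedPiece {ι : Type*} [Fintype ι] (a : ι → ℕ) :
    Module.finrank ℂ (gradedPiece a) = ∑ i, (a i + 2).choose 2 := by
  rw [LinearEquiv.finrank_eq (gradedPieceEquiv a), Module.finrank_pi_fintype]
  simp [finrank_homogeneousSubmodule]

theorem finrank_map_add_finrank_of_le {V W : Type*} [AddCommGroup V] [Module ℂ V]
    [AddCommGroup W] [Module ℂ W] (P Q : Submodule ℂ V) [Module.Finite ℂ P] (g : V →ₗ[ℂ] W)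
    (hQ : ∀ v, v ∈ Q ↔ v ∈ P ∧ g v = 0) :
    Module.finrank ℂ (P.map g) + Module.finrank ℂ Q = Module.finrank ℂ P := by
  have h := LinearMap.finrank_range_add_finrank_ker (g.domRestrict P)
  have h1 : LinearMap.range (g.domRestrict P) = P.map g := by
    ext w; simp [Submodule.mem_map]
  have h2 : Q = (LinearMap.ker (g.domRestrict P)).map P.subtype := by
    ext v
    simp only [hQ, Submodule.mem_map, LinearMap.mem_ker, Submodule.subtype_apply]
    constructor
    · rintro ⟨h, h'⟩; exact ⟨⟨v, h⟩, h', rfl⟩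
    · rintro ⟨w, h, rfl⟩; exact ⟨w.2, h⟩
  rw [h1] at h
  rw [h2, LinearEquiv.finrank_eq (Submodule.equivMapOfInjective P.subtype
    P.injective_subtype _).symm]
  exact h

/-- The image of a graded piece under a linear map over the polynomial ring. -/
noncomputable def gradedImage {ι M : Type*} [AddCommGroup M] [Module PolyS M] [Module ℂ M]
    [IsScalarTower ℂ PolyS M] (a : ι → ℕ) (A : (ι → PolyS) →ₗ[PolyS] M) : Submodule ℂ M :=
  (gradedPiece a).map (A.restrictScalars ℂ)

theorem finrank_gradedImage_of_injective {ι M : Type*} [Fintype ι] [AddCommGroup M]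
    [Module PolyS M] [Module ℂ M] [IsScalarTower ℂ PolyS M] (a : ι → ℕ)
    {A : (ι → PolyS) →ₗ[PolyS] M} (hA : Function.Injective A) :
    Module.finrank ℂ (gradedImage a A) = ∑ i, (a i + 2).choose 2 := by
  rw [← finrank_gradedPiece]
  exact (LinearEquiv.finrank_eq (Submodule.equivMapOfInjective (A.restrictScalars ℂ) hA _)).symm

theorem finrank_gradedImage_add {ι κ M : Type*} [Fintype ι] [Fintype κ] [AddCommGroup M]
    [Module PolyS M] [Module ℂ M] [IsScalarTower ℂ PolyS M] {a : ι → ℕ} {b : κ → ℕ}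
    {A : ι → κ → PolyS} (hA : IsHomogeneousMatrix a b A) {B : (κ → PolyS) →ₗ[PolyS] M}
    (hAB : Function.Exact (Fintype.linearCombination PolyS A) B) :
    Module.finrank ℂ (gradedImage b B) +
      Module.finrank ℂ (gradedImage a (Fintype.linearCombination PolyS A)) =
      ∑ j, (b j + 2).choose 2 := by
  rw [← finrank_gradedPiece]
  refine finrank_map_add_finrank_of_le _ _ _ fun v => ⟨?_, ?_⟩
  · rintro ⟨w, hw, rfl⟩
    refine ⟨?_, hAB.apply_apply_eq_zero w⟩
    have := gradedProj_linearCombination hA w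
    rw [gradedProj_eq_self hw] at this
    simp only [LinearMap.restrictScalars_apply]
    rw [← this]
    exact gradedProj_mem _ _
  · rintro ⟨hv, hv0⟩
    obtain ⟨w, rfl⟩ := (hAB v).1 hv0
    refine ⟨gradedProj a w, gradedProj_mem _ _, ?_⟩
    have := gradedProj_linearCombination hA w
    rw [gradedProj_eq_self hv] at this
    exact this.symm

theorem hilbertFunction_add {ι : Type*} [Fintype ι] {c : ι → PolyS} {I : Ideal PolyS}
    (hI : LinearMap.range (Fintype.linearCombination PolyS c) = I) {a : ι → ℕ} {k : ℕ}
    (hc : ∀ i, c i = 0 ∨ ∃ n, a i + n = k ∧ (c i).IsHomogeneous n) :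
    hilbertFunction I k +
      Module.finrank ℂ (gradedImage a (Fintype.linearCombination PolyS c)) =
      (k + 2).choose 2 := by
  rw [← finrank_homogeneousSubmodule]
  refine finrank_map_add_finrank_of_le _ _ _ fun v => ?_
  have hq : (Ideal.Quotient.mkₐ ℂ I).toLinearMap v = 0 ↔ v ∈ I := by
    simp [Ideal.Quotient.eq_zero_iff_mem]
  rw [hq]
  constructor
  · rintro ⟨w, hw, rfl⟩
    refine ⟨?_, hI ▸ ⟨w, rfl⟩⟩
    have := homogeneousComponent_linearCombination hc w
    rw [gradedProj_eq_self hw] at this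
    simp only [LinearMap.restrictScalars_apply]
    rw [← this]
    exact homogeneousComponent_mem _ _
  · rintro ⟨hv, hvI⟩
    rw [← hI] at hvI
    obtain ⟨w, rfl⟩ := hvI
    refine ⟨gradedProj a w, gradedProj_mem _ _, ?_⟩
    have := homogeneousComponent_linearCombination hc w
    rw [homogeneousComponent_eq_self hv] at this
    exact this.symm

/-! ### Coprime forms in the Jacobian ideal and a bound on the Hilbert function. -/

/-- A nonzero derivative has total degree strictly below that of p, so it cannot be a multiple of p.
-/
theorem pderiv_eq_zero_of_dvd {p : PolyS} {i : Fin 3} (h : p ∣ pderiv i p) :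
    pderiv i p = 0 := by
  by_contra hne
  obtain ⟨q, hq⟩ := h
  have hp : p ≠ 0 := by rintro rfl; simp at hne
  have hq0 : q ≠ 0 := by rintro rfl; simp [hq] at hne
  have h1 : (pderiv i p).totalDegree = p.totalDegree + q.totalDegree := by
    rw [hq, totalDegree_mul_of_isDomain hp hq0]
  obtain ⟨m, hm, hdeg⟩ := Finset.exists_mem_eq_sup _ (support_nonempty.2 hne)
    fun s : Fin 3 →₀ ℕ => s.degree
  have h2 : (pderiv i p).totalDegree = m.degree := hdeg
  have h3 : m + Finsupp.single i 1 ∈ p.support := by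
    rw [mem_support_iff] at hm ⊢
    rw [coeff_pderiv] at hm
    exact left_ne_zero_of_mul hm
  have h4 : (m + Finsupp.single i 1).degree ≤ p.totalDegree := le_totalDegree h3
  simp at h4
  omega

theorem exists_pderiv_ne_zero_of_prime {p : PolyS} (hp : Prime p) :
    ∃ i, pderiv i p ≠ 0 := by
  by_contra! h
  have hpC : p = C (coeff 0 p) := by
    ext m
    rw [coeff_C]
    split_ifs with hm
    · rw [hm]
    · obtain ⟨i, hi⟩ : ∃ i, m i ≠ 0 := by
        by_contra! h0
        exact hm (Finsupp.ext fun i => (h0 i).symm)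
      have h1 : m - Finsupp.single i 1 + Finsupp.single i 1 = m :=
        tsub_add_cancel_of_le (by simpa [Nat.one_le_iff_ne_zero] using hi)
      have h2 : coeff (m - Finsupp.single i 1) (pderiv i p) = 0 := by simp [h i]
      rw [coeff_pderiv, h1] at h2
      rcases mul_eq_zero.1 h2 with h3 | h3
      · exact h3
      · norm_cast at h3
  apply hp.not_isUnit
  rw [hpC]
  refine (isUnit_iff_ne_zero.2 fun h0 => hp.ne_zero ?_).map C
  rw [hpC, h0, map_zero]

/-- If p divides all partials, Euler's formula gives p ∣ f. Write f = p g with p ∤ g by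
squarefreeness. The product rule then yields p ∣ ∂_i p for every i, which is impossible for a
nonconstant p in characteristic zero. -/
theorem not_forall_dvd_pderiv {d : ℕ} {f : PolyS} (hf : IsReducedPlaneCurve d f) {p : PolyS}
    (hp : Prime p) : ∃ i, ¬ p ∣ pderiv i f := by
  by_contra! h
  have hd := hf.three_le
  have hpf : p ∣ f := by
    have h1 : p ∣ (d : PolyS) * f := by
      have h2 := hf.isHomogeneous.sum_X_mul_pderiv
      rw [nsmul_eq_mul] at h2
      rw [← h2]
      exact Finset.dvd_sum fun i _ => (h i).mul_left _
    have hu : IsUnit (d : PolyS) := by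
      have : IsUnit (C (d : ℂ) : PolyS) :=
        (isUnit_iff_ne_zero.2 (by norm_cast; omega)).map C
      simpa using this
    exact (hu.dvd_mul_left).1 h1
  obtain ⟨g, rfl⟩ := hpf
  have hpg : ¬ p ∣ g := fun hg => hp.not_isUnit (hf.squarefree p (mul_dvd_mul_left p hg))
  obtain ⟨i, hi⟩ := exists_pderiv_ne_zero_of_prime hp
  refine hi (pderiv_eq_zero_of_dvd ?_)
  have h1 := h i
  rw [pderiv_mul] at h1
  exact (hp.dvd_or_dvd ((dvd_add_left (dvd_mul_right p _)).1 h1)).resolve_right hpg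

/-- If no prime divides `a`, `b` and `c`, then some `b + t c` is coprime to `a ≠ 0`. -/
theorem exists_isRelPrime_add_C_mul {a b c : PolyS} (ha : a ≠ 0)
    (h : ∀ p, Prime p → p ∣ a → p ∣ b → ¬ p ∣ c) :
    ∃ t : ℂ, IsRelPrime a (b + C t * c) := by
  classical
  by_contra! hcon
  have h1 : ∀ t : ℂ, ∃ p ∈ (UniqueFactorizationMonoid.factors a).toFinset,
      p ∣ b + C t * c := by
    intro t
    have h2 := hcon t
    rw [UniqueFactorizationMonoid.isRelPrime_iff_no_prime_factors ha] at h2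
    push Not at h2
    obtain ⟨p, hpa, hpb, hp⟩ := h2
    obtain ⟨q, hq, hpq⟩ := UniqueFactorizationMonoid.exists_mem_factors_of_dvd ha
      hp.irreducible hpa
    exact ⟨q, by simpa using hq, hpq.symm.dvd.trans hpb⟩
  choose F hF hdvd using h1
  -- Pigeonhole: infinitely many t, finitely many prime factors of a. A prime dividing b + s c and b
  -- + t c with s ≠ t divides both b and c.
  obtain ⟨s, t, hst, hFst⟩ := Finite.exists_ne_map_eq_of_infinite
    fun t : ℂ => (⟨F t, hF t⟩ : (UniqueFactorizationMonoid.factors a).toFinset)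
  have hFst : F s = F t := congrArg Subtype.val hFst
  have hmem : F t ∈ UniqueFactorizationMonoid.factors a := by simpa using hF t
  have hprime := UniqueFactorizationMonoid.prime_of_factor _ hmem
  have hda := UniqueFactorizationMonoid.dvd_of_mem_factors hmem
  have hc : F t ∣ c := by
    have h3 : F t ∣ C (s - t) * c := by
      have h4 := dvd_sub (hFst ▸ hdvd s) (hdvd t)
      have h5 : b + C s * c - (b + C t * c) = C (s - t) * c := by
        rw [map_sub]; ring
      rwa [h5] at h4
    have hu : IsUnit (C (s - t) : PolyS) :=
      (isUnit_iff_ne_zero.2 (sub_ne_zero.2 hst)).map C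
    exact (hu.dvd_mul_left).1 h3
  have hb : F t ∣ b := (dvd_add_left (hc.mul_left _)).1 (hdvd t)
  exact h _ hprime hda hb hc

theorem IsReducedPlaneCurve.exists_pderiv_ne_zero {d : ℕ} {f : PolyS}
    (hf : IsReducedPlaneCurve d f) : ∃ i, pderiv i f ≠ 0 := by
  by_contra! h
  have h0 : f = 0 := by
    have h2 := hf.isHomogeneous.sum_X_mul_pderiv
    have hd := hf.three_le
    simp only [h, mul_zero, Finset.sum_const_zero, nsmul_eq_mul] at h2
    rcases mul_eq_zero.1 h2.symm with h3 | h3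
    · norm_cast at h3; omega
    · exact h3
  exact hf.squarefree.ne_zero h0

theorem IsReducedPlaneCurve.pderiv_isHomogeneous {d : ℕ} {f : PolyS}
    (hf : IsReducedPlaneCurve d f) (i : Fin 3) : (pderiv i f).IsHomogeneous (d - 1) :=
  hf.isHomogeneous.pderiv

theorem range_jacobianMap (f : PolyS) :
    LinearMap.range (Fintype.linearCombination PolyS fun i => pderiv i f) = jacobianIdeal f :=
  Fintype.range_linearCombination _ _

/-- The Jacobian ideal of a reduced curve contains two coprime forms of degree `d - 1`. -/
theorem exists_isRelPrime_mem_jacobianIdeal {d : ℕ} {f : PolyS}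
    (hf : IsReducedPlaneCurve d f) :
    ∃ g h : PolyS, g ≠ 0 ∧ g.IsHomogeneous (d - 1) ∧ h.IsHomogeneous (d - 1) ∧
      g ∈ jacobianIdeal f ∧ h ∈ jacobianIdeal f ∧ IsRelPrime g h := by
  obtain ⟨i, hi⟩ := hf.exists_pderiv_ne_zero
  have hmem : ∀ j, pderiv j f ∈ jacobianIdeal f := fun j => Ideal.subset_span ⟨j, rfl⟩
  have key : ∀ j k : Fin 3, (∀ l, l = i ∨ l = j ∨ l = k) → ∃ g h : PolyS, g ≠ 0 ∧
      g.IsHomogeneous (d - 1) ∧ h.IsHomogeneous (d - 1) ∧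
      g ∈ jacobianIdeal f ∧ h ∈ jacobianIdeal f ∧ IsRelPrime g h := by
    intro j k hjk
    obtain ⟨t, ht⟩ := exists_isRelPrime_add_C_mul (b := pderiv j f) (c := pderiv k f) hi (by
      intro p hp h1 h2 h3
      obtain ⟨l, hl⟩ := not_forall_dvd_pderiv hf hp
      rcases hjk l with rfl | rfl | rfl <;> exact hl ‹_›)
    exact ⟨_, _, hi, hf.pderiv_isHomogeneous i,
      (hf.pderiv_isHomogeneous j).add ((hf.pderiv_isHomogeneous k).C_mul t),
      hmem i, add_mem (hmem j) (Ideal.mul_mem_left _ _ (hmem k)), ht⟩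
  fin_cases i
  · exact key 1 2 (by decide)
  · exact key 0 2 (by decide)
  · exact key 0 1 (by decide)

theorem exact_koszul_pair {g h : PolyS} (hg : g ≠ 0) (hgh : IsRelPrime g h) :
    Function.Exact (Fintype.linearCombination PolyS ![![h, -g]])
      (Fintype.linearCombination PolyS ![g, h]) := by
  intro v
  simp only [Fintype.linearCombination_apply, Fin.sum_univ_two, smul_eq_mul, Set.mem_range,
    Matrix.cons_val_zero, Matrix.cons_val_one]
  constructor
  · intro hv
    have h1 : g ∣ v 1 * h := ⟨-v 0, by linear_combination hv⟩
    obtain ⟨u, hu⟩ := hgh.dvd_of_dvd_mul_right h1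
    have h0 : v 0 = - u * h := by
      apply mul_right_cancel₀ hg
      rw [hu] at hv
      linear_combination hv
    refine ⟨fun _ => -u, ?_⟩
    funext i
    fin_cases i
    · simp [h0]
    · simp [hu, mul_comm]
  · rintro ⟨w, rfl⟩
    simp
    ring

/-- With D = d - 1 and coprime forms g, h of degree D in J_f, the Koszul complex gives S/(g, h)
dimension C(2D+n+2, 2) - 2 C(D+n+2, 2) + C(n+2, 2) = D² in degree 2D + n. The algebra M(f) is a
quotient of S/(g, h). -/
theorem hilbertFunction_jacobianIdeal_le {d : ℕ} {f : PolyS} (hf : IsReducedPlaneCurve d f)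
    {k : ℕ} (hk : 2 * (d - 1) ≤ k) :
    hilbertFunction (jacobianIdeal f) k ≤ (d - 1) ^ 2 := by
  obtain ⟨g, h, hg0, hg, hh, hgJ, hhJ, hrel⟩ := exists_isRelPrime_mem_jacobianIdeal hf
  set D := d - 1
  obtain ⟨n, rfl⟩ := Nat.exists_eq_add_of_le hk
  have h1 := finrank_gradedImage_add (a := fun _ : Fin 1 => n)
    (b := fun _ : Fin 2 => D + n) (A := ![![h, -g]]) (by
      intro i j
      refine Or.inr ⟨D, by grind, ?_⟩
      fin_cases i; fin_cases j
      · exact hh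
      · exact hg.neg) (exact_koszul_pair hg0 hrel)
  have hinj : Function.Injective (Fintype.linearCombination PolyS ![![h, -g]]) := by
    rw [injective_iff_map_eq_zero]
    intro v hv
    have h2 := congrFun hv 1
    simp [Fintype.linearCombination_apply, hg0] at h2
    funext i
    fin_cases i
    exact h2
  rw [finrank_gradedImage_of_injective _ hinj] at h1
  have hspan : LinearMap.range (Fintype.linearCombination PolyS ![g, h]) =
      Ideal.span (Set.range ![g, h]) := Fintype.range_linearCombination _ _
  have h2 := hilbertFunction_add hspan (a := fun _ : Fin 2 => D + n) (k := 2 * D + n) (by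
    intro i
    refine Or.inr ⟨D, by grind, ?_⟩
    fin_cases i
    · exact hg
    · exact hh)
  have h3 := hilbertFunction_add (range_jacobianMap f) (a := fun _ : Fin 3 => D + n) (k := 2 * D + n)
    fun i => Or.inr ⟨D, by grind, hf.pderiv_isHomogeneous i⟩
  have hle : hilbertFunction (jacobianIdeal f) (2 * D + n) ≤
      hilbertFunction (Ideal.span (Set.range ![g, h])) (2 * D + n) := by
    have hI : Ideal.span (Set.range ![g, h]) ≤ jacobianIdeal f := by
      rw [Ideal.span_le]
      rintro _ ⟨i, rfl⟩
      fin_cases i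
      · exact hgJ
      · exact hhJ
    have hmap : (homogeneousSubmodule (Fin 3) ℂ (2 * D + n)).map
        (Ideal.Quotient.mkₐ ℂ (jacobianIdeal f)).toLinearMap =
        ((homogeneousSubmodule (Fin 3) ℂ (2 * D + n)).map
        (Ideal.Quotient.mkₐ ℂ (Ideal.span (Set.range ![g, h]))).toLinearMap).map
          (Ideal.Quotient.factorₐ ℂ hI).toLinearMap := by
      rw [← Submodule.map_comp]
      rfl
    unfold hilbertFunction
    rw [hmap]
    exact Submodule.finrank_map_le _ _
  simp only [Fin.sum_univ_two, Fin.sum_univ_one] at h1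
  have h4 : hilbertFunction (Ideal.span (Set.range ![g, h])) (2 * D + n) = D ^ 2 := by
    have q1 := congrArg (Nat.cast : ℕ → ℚ) h1
    have q2 := congrArg (Nat.cast : ℕ → ℚ) h2
    push_cast [Nat.cast_choose_two] at q1 q2
    have : (hilbertFunction (Ideal.span (Set.range ![g, h])) (2 * D + n) : ℚ) = (D : ℚ) ^ 2 := by
      linear_combination q2 - q1
    exact_mod_cast this
  omega

/-! ### Koszul complex of the variables and freeness of third syzygies. -/

theorem X_ne_zero' (i : Fin 3) : (X i : PolyS) ≠ 0 := X_ne_zero i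

theorem X_dvd_of_dvd_X_mul {i j : Fin 3} (hij : i ≠ j) {p : PolyS}
    (h : (X i : PolyS) ∣ X j * p) : (X i : PolyS) ∣ p :=
  ((X_prime (i := i)).dvd_or_dvd h).resolve_left fun h' => hij (X_dvd_X.1 h')

/-- Exactness of the Koszul complex of `x, y, z` at its first term. -/
theorem exists_koszul {b c e : PolyS} (h : X 0 * b + X 1 * c + X 2 * e = 0) :
    ∃ u v w : PolyS, b = X 1 * u + X 2 * v ∧ c = -(X 0 * u) + X 2 * w ∧
      e = -(X 0 * v) - X 1 * w := by
  -- The variable z is a nonzerodivisor modulo the monomial ideal (x, y).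
  have he : e ∈ Ideal.span ((X : Fin 3 → PolyS) '' {0, 1}) := by
    have h1 : X 2 * e ∈ Ideal.span ((X : Fin 3 → PolyS) '' {0, 1}) := by
      have h2 : X 2 * e = -b * X 0 + -c * X 1 := by linear_combination h
      rw [h2]
      exact add_mem (Ideal.mul_mem_left _ _ (Ideal.subset_span ⟨0, by simp, rfl⟩))
        (Ideal.mul_mem_left _ _ (Ideal.subset_span ⟨1, by simp, rfl⟩))
    rw [mem_ideal_span_X_image] at h1 ⊢
    intro m hm
    obtain ⟨i, hi, hmi⟩ := h1 (Finsupp.single 2 1 + m) (by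
      rw [mem_support_iff, coeff_X_mul]
      exact mem_support_iff.1 hm)
    refine ⟨i, hi, ?_⟩
    have : i ≠ 2 := by rintro rfl; simp at hi
    simpa [Finsupp.single_apply, this.symm] using hmi
  rw [Set.image_pair, Ideal.mem_span_pair] at he
  obtain ⟨v, w, hvw⟩ := he
  have h1 : X 0 * (b - X 2 * -v) + X 1 * (c - X 2 * -w) = 0 := by
    linear_combination h + X 2 * hvw
  obtain ⟨u, hu⟩ := X_dvd_of_dvd_X_mul (i := 1) (j := 0) (by decide)
    (p := b - X 2 * -v) ⟨-(c - X 2 * -w), by linear_combination h1⟩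
  refine ⟨u, -v, -w, by linear_combination hu, ?_, by linear_combination -hvw⟩
  apply mul_left_cancel₀ (X_ne_zero' 1)
  linear_combination h1 - X 0 * hu

theorem exists_koszul_pi {ι : Type*} {b c e : ι → PolyS}
    (h : (X 0 : PolyS) • b + (X 1 : PolyS) • c + (X 2 : PolyS) • e = 0) :
    ∃ u v w : ι → PolyS, b = (X 1 : PolyS) • u + (X 2 : PolyS) • v ∧
      c = -((X 0 : PolyS) • u) + (X 2 : PolyS) • w ∧
      e = -((X 0 : PolyS) • v) - (X 1 : PolyS) • w := by
  choose u v w h1 h2 h3 using fun i => exists_koszul (b := b i) (c := c i) (e := e i)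
    (by simpa using congrFun h i)
  exact ⟨u, v, w, funext h1, funext h2, funext h3⟩

/-- The first Koszul homology of `x, y, z` vanishes on a third syzygy module. -/
theorem exists_koszul_ker {ι κ : Type*} {A : (ι → PolyS) →ₗ[PolyS] (κ → PolyS)}
    {g : (κ → PolyS) →ₗ[PolyS] PolyS} (hAg : Function.Exact A g) {b c e : ι → PolyS}
    (hb : A b = 0) (hc : A c = 0) (he : A e = 0)
    (h : (X 0 : PolyS) • b + (X 1 : PolyS) • c + (X 2 : PolyS) • e = 0) :
    ∃ u v w : ι → PolyS, A u = 0 ∧ A v = 0 ∧ A w = 0 ∧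
      b = (X 1 : PolyS) • u + (X 2 : PolyS) • v ∧
      c = -((X 0 : PolyS) • u) + (X 2 : PolyS) • w ∧
      e = -((X 0 : PolyS) • v) - (X 1 : PolyS) • w := by
  obtain ⟨u, v, w, rfl, rfl, rfl⟩ := exists_koszul_pi h
  simp only [map_add, map_neg, map_sub, map_smul] at hb hc he
  -- The equations A b = A c = 0 force (A u, A v, A w) = (z t, -y t, x t) for some t. Then g t = 0,
  -- so t = A s, and subtracting s·(z, -y, x) from (u, v, w) puts them in the kernel without
  -- changing b, c, e.
  have hdvd : ∀ j, (X 2 : PolyS) ∣ A u j := fun j =>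
    X_dvd_of_dvd_X_mul (i := 2) (j := 1) (by decide) ⟨-(A v j), by
      have := congrFun hb j
      simp at this
      linear_combination this⟩
  choose t ht using hdvd
  have hu : A u = (X 2 : PolyS) • t := funext ht
  have hv : A v = -((X 1 : PolyS) • t) := by
    funext j
    apply mul_left_cancel₀ (X_ne_zero' 2)
    have := congrFun hb j
    simp [ht] at this ⊢
    linear_combination this
  have hw : A w = (X 0 : PolyS) • t := by
    funext j
    apply mul_left_cancel₀ (X_ne_zero' 2)
    have := congrFun hc j
    simp [ht] at this
    change X 2 * A w j = X 2 * (X 0 * t j)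
    linear_combination this
  have hgt : g t = 0 := by
    have h1 := hAg.apply_apply_eq_zero u
    rw [hu, map_smul, smul_eq_mul] at h1
    exact (mul_eq_zero.1 h1).resolve_left (X_ne_zero' 2)
  obtain ⟨s, rfl⟩ := (hAg t).1 hgt
  refine ⟨u - (X 2 : PolyS) • s, v + (X 1 : PolyS) • s, w - (X 0 : PolyS) • s,
    by simp [hu], by simp [hv], by simp [hw], ?_, ?_, ?_⟩
  · simp only [smul_sub, smul_add, smul_smul, mul_comm (X 2 : PolyS) (X 1)]
    abel
  · simp only [smul_sub, smul_smul, mul_comm (X 2 : PolyS) (X 0)]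
    abel
  · simp only [smul_sub, smul_add, smul_smul, mul_comm (X 1 : PolyS) (X 0)]
    abel

theorem exists_eq_of_constantCoeff_eq_zero {p : PolyS} (hp : constantCoeff p = 0) :
    ∃ b c e : PolyS, p = X 0 * b + X 1 * c + X 2 * e := by
  have h1 : p ∈ idealOfVars (Fin 3) ℂ := by
    rw [← pow_one (idealOfVars (Fin 3) ℂ), mem_pow_idealOfVars_iff']
    intro x hx
    have : x = 0 := (Finsupp.degree_eq_zero_iff x).1 (by simpa using hx)
    rw [this]; exact hp
  rw [idealOfVars, Ideal.mem_span_range_iff_exists_fun] at h1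
  obtain ⟨c, rfl⟩ := h1
  exact ⟨c 0, c 1, c 2, by simp [Fin.sum_univ_three, mul_comm]⟩

/-- Generators of a third syzygy module all of whose relations have coefficients without
constant term are linearly independent. -/
theorem linearIndependent_of_third_syzygy {ι κ η : Type*} [Fintype η]
    {A : (ι → PolyS) →ₗ[PolyS] (κ → PolyS)}
    {g : (κ → PolyS) →ₗ[PolyS] PolyS} (hAg : Function.Exact A g) {σ : η → ι → PolyS}
    (hspan : Submodule.span PolyS (Set.range σ) = LinearMap.ker A)
    (hmin : ∀ a : η → PolyS, Fintype.linearCombination PolyS σ a = 0 →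
      ∀ i, constantCoeff (a i) = 0) :
    LinearIndependent PolyS σ := by
  set T := Fintype.linearCombination PolyS σ
  have hker : ∀ v, A v = 0 ↔ ∃ a, T a = v := by
    intro v
    rw [← LinearMap.mem_ker, ← hspan, ← Fintype.range_linearCombination, LinearMap.mem_range]
  -- A relation a lies in (x, y, z) times the free module. Correcting its coefficients b, c, e by a
  -- Koszul boundary makes them relations themselves.
  have hdec : ∀ a, T a = 0 → ∃ b c e, T b = 0 ∧ T c = 0 ∧ T e = 0 ∧
      a = (X 0 : PolyS) • b + (X 1 : PolyS) • c + (X 2 : PolyS) • e := by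
    intro a ha
    choose b c e hbce using fun i => exists_eq_of_constantCoeff_eq_zero (hmin a ha i)
    have habce : a = (X 0 : PolyS) • b + (X 1 : PolyS) • c + (X 2 : PolyS) • e := funext hbce
    have h0 : (X 0 : PolyS) • T b + (X 1 : PolyS) • T c + (X 2 : PolyS) • T e = 0 := by
      rw [← ha, habce]; simp only [map_add, map_smul]
    obtain ⟨u, v, w, hu, hv, hw, h1, h2, h3⟩ := exists_koszul_ker hAg
      ((hker _).2 ⟨b, rfl⟩) ((hker _).2 ⟨c, rfl⟩) ((hker _).2 ⟨e, rfl⟩) h0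
    obtain ⟨u, rfl⟩ := (hker _).1 hu
    obtain ⟨v, rfl⟩ := (hker _).1 hv
    obtain ⟨w, rfl⟩ := (hker _).1 hw
    refine ⟨b - (X 1 : PolyS) • u - (X 2 : PolyS) • v,
      c + (X 0 : PolyS) • u - (X 2 : PolyS) • w,
      e + (X 0 : PolyS) • v + (X 1 : PolyS) • w, ?_, ?_, ?_, ?_⟩
    · simp only [map_sub, map_smul, h1]; abel
    · simp only [map_sub, map_add, map_smul, h2]; abel
    · simp only [map_add, map_smul, h3]; abel
    · rw [habce]
      simp only [smul_sub, smul_add, smul_smul, mul_comm (X 2 : PolyS) (X 0),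
        mul_comm (X 2 : PolyS) (X 1), mul_comm (X 1 : PolyS) (X 0)]
      abel
  -- Iterating `hdec` puts the entries of every relation in all powers of (x, y, z), so they vanish.
  have hpow : ∀ n a, T a = 0 → ∀ i, a i ∈ idealOfVars (Fin 3) ℂ ^ n := by
    intro n
    induction n with
    | zero => simp
    | succ n ih =>
      intro a ha i
      obtain ⟨b, c, e, hb, hc, he, rfl⟩ := hdec a ha
      have hX : ∀ j, (X j : PolyS) ∈ idealOfVars (Fin 3) ℂ := fun j =>
        Ideal.subset_span ⟨j, rfl⟩
      rw [pow_succ']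
      exact add_mem (add_mem (Ideal.mul_mem_mul (hX 0) (ih b hb i))
        (Ideal.mul_mem_mul (hX 1) (ih c hc i))) (Ideal.mul_mem_mul (hX 2) (ih e he i))
  rw [Fintype.linearIndependent_iff]
  intro a ha i
  ext m
  exact (mem_pow_idealOfVars_iff' _ _).1 (hpow (m.degree + 1) a ha i) m (Nat.lt_succ_self _)

/-! ### Minimal systems of homogeneous generators. -/

/-- In a relation between homogeneous vectors, a generator whose coefficient has a non-zero
constant term is redundant. -/
theorem mem_span_image_compl_of_relation {η ι : Type*} [Fintype η] [DecidableEq η]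
    {v : η → ι → PolyS} {n : η → ℕ} (hv : ∀ i j, (v i j).IsHomogeneous (n i)) {a : η → PolyS}
    (ha : Fintype.linearCombination PolyS v a = 0) {i₀ : η}
    (h₀ : constantCoeff (a i₀) ≠ 0) : v i₀ ∈ Submodule.span PolyS (v '' {i₀}ᶜ) := by
  -- These are the coefficients of the component of the relation in degree n i₀; there the
  -- coefficient of v i₀ is a nonzero constant, hence invertible.
  set c : η → PolyS := fun i =>
    if n i ≤ n i₀ then homogeneousComponent (n i₀ - n i) (a i) else 0 with hc
  have hrel : ∑ i, c i • v i = 0 := by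
    funext j
    have h1 := congrArg (homogeneousComponent (n i₀)) (congrFun ha j)
    rw [linearCombination_apply_coord] at h1
    simp only [Fintype.linearCombination_apply, smul_eq_mul, map_sum, Pi.zero_apply,
      map_zero] at h1
    simp only [Finset.sum_apply, Pi.smul_apply, smul_eq_mul, Pi.zero_apply]
    rw [← h1]
    refine Finset.sum_congr rfl fun i _ => ?_
    rw [homogeneousComponent_mul_of_isHomogeneous (hv i j), hc]
    simp only [ite_mul, zero_mul]
  have hc₀ : c i₀ = C (constantCoeff (a i₀)) := by
    simp [hc, homogeneousComponent_zero, constantCoeff_eq]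
  rw [← Finset.add_sum_erase _ _ (Finset.mem_univ i₀), hc₀] at hrel
  have hsum : ∑ i ∈ Finset.univ.erase i₀, c i • v i ∈ Submodule.span PolyS (v '' {i₀}ᶜ) :=
    Submodule.sum_mem _ fun i hi => Submodule.smul_mem _ _
      (Submodule.subset_span ⟨i, by simpa using hi, rfl⟩)
  have h2 : v i₀ = (C (constantCoeff (a i₀))⁻¹ : PolyS) •
      -∑ i ∈ Finset.univ.erase i₀, c i • v i := by
    rw [← eq_neg_of_add_eq_zero_left hrel, smul_smul, ← C_mul, inv_mul_cancel₀ h₀, C_1,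
      one_smul]
  rw [h2]
  exact Submodule.smul_mem _ _ (Submodule.neg_mem _ hsum)

theorem span_image_compl_eq {η ι : Type*} {v : η → ι → PolyS} {i₀ : η}
    (h : v i₀ ∈ Submodule.span PolyS (v '' {i₀}ᶜ)) :
    Submodule.span PolyS (v '' {i₀}ᶜ) = Submodule.span PolyS (Set.range v) := by
  rw [← Submodule.span_insert_eq_span h, ← Set.image_insert_eq, ← Set.union_singleton,
    Set.compl_union_self, Set.image_univ]

theorem mem_span_gradedProj {ι : Type*} [Finite ι] (v : ι → PolyS) :
    v ∈ Submodule.span PolyS (Set.range fun n : ℕ => gradedProj (fun _ => n) v) := by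
  cases nonempty_fintype ι
  set N := Finset.univ.sup fun i => (v i).totalDegree
  have h : v = ∑ n ∈ Finset.range (N + 1), gradedProj (fun _ => n) v := by
    funext i
    rw [Finset.sum_apply]
    conv_lhs => rw [← sum_homogeneousComponent (v i)]
    refine Finset.sum_subset (fun n hn => ?_) fun n _ hn => ?_
    · have : (v i).totalDegree ≤ N :=
        Finset.le_sup (f := fun i => (v i).totalDegree) (Finset.mem_univ i)
      simp at hn ⊢
      omega
    · exact homogeneousComponent_eq_zero _ _ (by simpa using hn)
  have hmem : ∑ n ∈ Finset.range (N + 1), gradedProj (fun _ => n) v ∈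
      Submodule.span PolyS (Set.range fun n : ℕ => gradedProj (fun _ => n) v) :=
    Submodule.sum_mem _ fun n _ => Submodule.subset_span (Set.mem_range_self n)
  rwa [← h] at hmem

/-- A graded submodule of a free module has a minimal system of homogeneous generators. -/
theorem exists_minimal_homogeneous_generators {ι : Type*} [Finite ι]
    (K : Submodule PolyS (ι → PolyS))
    (hK : ∀ v ∈ K, ∀ n : ℕ, gradedProj (fun _ => n) v ∈ K) :
    ∃ (s : ℕ) (n : Fin s → ℕ) (σ : Fin s → ι → PolyS), Monotone n ∧
      (∀ i j, (σ i j).IsHomogeneous (n i)) ∧ Submodule.span PolyS (Set.range σ) = K ∧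
      ∀ i, σ i ∉ Submodule.span PolyS (σ '' {i}ᶜ) := by
  classical
  set H : Set (ι → PolyS) := {v | v ∈ K ∧ ∃ n, ∀ j, (v j).IsHomogeneous n}
  have hspan : Submodule.span PolyS H = K := by
    refine le_antisymm (Submodule.span_le.2 fun v hv => hv.1) fun v hv => ?_
    refine Submodule.span_mono ?_ (mem_span_gradedProj v)
    rintro _ ⟨n, rfl⟩
    exact ⟨hK v hv n, n, fun j => homogeneousComponent_isHomogeneous _ _⟩
  have hex : ∃ c, ∃ T : Finset (ι → PolyS), T.card = c ∧ (T : Set (ι → PolyS)) ⊆ H ∧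
      Submodule.span PolyS (T : Set (ι → PolyS)) = K := by
    have hfg : (Submodule.span PolyS H).FG := IsNoetherian.noetherian _
    obtain ⟨T, hT, hT'⟩ := (Submodule.fg_span_iff_fg_span_finset_subset H).1 hfg
    exact ⟨_, T, rfl, hT, hT'.symm.trans hspan⟩
  -- A homogeneous generating set of least cardinality is irredundant; sorting by degree then gives
  -- monotonicity.
  obtain ⟨T, hcard, hTH, hTK⟩ := Nat.find_spec hex
  choose n₀ hn₀ using fun i : Fin T.card => (hTH (T.equivFin.symm i).2).2
  set π := Tuple.sort n₀
  set σ : Fin T.card → ι → PolyS := fun i => (T.equivFin.symm (π i)).1 with hσ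
  have hinj : Function.Injective σ :=
    Subtype.val_injective.comp (T.equivFin.symm.injective.comp π.injective)
  have hrange : Set.range σ = (T : Set (ι → PolyS)) := by
    ext v
    constructor
    · rintro ⟨i, rfl⟩; exact (T.equivFin.symm (π i)).2
    · intro hv
      exact ⟨π.symm (T.equivFin ⟨v, hv⟩), by simp [hσ]⟩
  refine ⟨T.card, n₀ ∘ π, σ, Tuple.monotone_sort n₀, fun i j => hn₀ (π i) j,
    by rw [hrange, hTK], fun i hi => ?_⟩
  have himg : σ '' {i}ᶜ = (T.erase (σ i) : Set (ι → PolyS)) := by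
    rw [Set.image_compl_eq_range_sdiff_image hinj, hrange]
    simp
  have hmem : σ i ∈ T := by
    have : σ i ∈ Set.range σ := ⟨i, rfl⟩
    rw [hrange] at this
    exact this
  refine Nat.find_min hex (m := (T.erase (σ i)).card) ?_ ⟨_, rfl, ?_, ?_⟩
  · rw [← hcard]
    exact Finset.card_erase_lt_of_mem hmem
  · exact fun v hv => hTH (Finset.mem_of_mem_erase hv)
  · rw [← himg, span_image_compl_eq hi, hrange, hTK]

/-! ### Existence of the minimal resolution. -/

theorem finrank_range_add_finrank_ker_pi {n : ℕ} {M : Type*} [AddCommGroup M] [Module PolyS M]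
    (A : (Fin n → PolyS) →ₗ[PolyS] M) :
    Module.finrank PolyS (LinearMap.range A) + Module.finrank PolyS (LinearMap.ker A) = n := by
  rw [← A.quotKerEquivRange.finrank_eq, Submodule.finrank_quotient_add_finrank]
  simp

theorem finrank_jacobianSyzygies {d : ℕ} {f : PolyS} (hf : IsReducedPlaneCurve d f) :
    Module.finrank PolyS (jacobianSyzygies f) = 2 := by
  have h1 := finrank_range_add_finrank_ker_pi (jacobianMap f)
  have h2 : Module.finrank PolyS (LinearMap.range (jacobianMap f)) = 1 := by
    apply le_antisymm
    · exact (Submodule.finrank_le _).trans (by simp)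
    · obtain ⟨i, hi⟩ := hf.exists_pderiv_ne_zero
      have hmem : pderiv i f ∈ LinearMap.range (jacobianMap f) := by
        have : LinearMap.range (jacobianMap f) = jacobianIdeal f := range_jacobianMap f
        rw [this]
        exact Ideal.subset_span ⟨i, rfl⟩
      have : Nontrivial (LinearMap.range (jacobianMap f)) :=
        ⟨⟨_, hmem⟩, 0, fun h => hi (congrArg Subtype.val h)⟩
      exact Module.finrank_pos
  rw [jacobianSyzygies]
  omega

theorem exact_of_span_eq {f : PolyS} {m : ℕ} {ρ : Fin m → Fin 3 → PolyS}
    (h : Submodule.span PolyS (Set.range ρ) = jacobianSyzygies f) :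
    Function.Exact (Fintype.linearCombination PolyS ρ) (jacobianMap f) := by
  rw [LinearMap.exact_iff, Fintype.range_linearCombination, h]
  rfl

theorem constantCoeff_eq_zero_of_isHomogeneous {p : PolyS} {n : ℕ} (hp : p.IsHomogeneous n)
    (hn : n ≠ 0) : constantCoeff p = 0 := by
  rw [constantCoeff_eq]
  exact hp.coeff_eq_zero (by simpa using hn.symm)

/-- The Milnor algebra of a reduced curve has a minimal graded free resolution of length three
which starts with a given minimal system of Jacobian syzygies of degree `r`. -/
theorem exists_isMinimalMilnorResolution {d r m : ℕ} {f : PolyS} (hf : IsReducedPlaneCurve d f)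
    (hr : 1 ≤ r) {ρ : Fin m → Fin 3 → PolyS}
    (hρ : IsMinimalSyzygyGenerators f (fun _ => r) ρ) :
    ∃ (e : Fin (m - 2) → ℕ) (σ : Fin (m - 2) → Fin m → PolyS),
      IsMinimalMilnorResolution f d (fun _ => r) e ρ σ := by
  have hd := hf.three_le
  have hex := exact_of_span_eq hρ.span_eq
  set A := Fintype.linearCombination PolyS ρ with hA
  obtain ⟨s, n, σ, hmono, hhom, hspan, hmin⟩ :=
    exists_minimal_homogeneous_generators (LinearMap.ker A) fun v hv k => by
      have hmat : IsHomogeneousMatrix (fun _ : Fin m => k) (fun _ : Fin 3 => k + r) ρ :=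
        fun i j => Or.inr ⟨r, rfl, hρ.isHomogeneous i j⟩
      have h1 := gradedProj_linearCombination hmat v
      rw [LinearMap.mem_ker] at hv ⊢
      rw [← hA, hv] at h1
      rw [← h1]
      funext i
      simp [gradedProj]
  have hli : LinearIndependent PolyS σ := linearIndependent_of_third_syzygy hex hspan
    fun a ha i => by
      by_contra h0
      exact hmin i (mem_span_image_compl_of_relation hhom ha h0)
  -- Rank count: D₀(f) has rank 2 and is the image of S^m, so the free kernel has rank s with 2 + s
  -- = m.
  have hs : s = m - 2 := by
    have h1 := finrank_span_eq_card hli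
    have h2 := finrank_range_add_finrank_ker_pi A
    have h3 : LinearMap.range A = jacobianSyzygies f := by
      rw [hA, Fintype.range_linearCombination, hρ.span_eq]
    rw [h3, finrank_jacobianSyzygies hf, ← hspan, h1] at h2
    simp at h2
    omega
  subst hs
  refine ⟨fun i => d - 1 + r + n i, σ, ?_⟩
  exact
    { monotone_dd := monotone_const
      monotone_e := fun i j hij => Nat.add_le_add_left (hmono hij) _
      homogeneous_ρ := hρ.isHomogeneous
      homogeneous_σ := fun i j => Or.inr ⟨n i, by push_cast [Nat.cast_sub (show 1 ≤ d by omega)]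
                                                  ring, hhom i j⟩
      injective := hli.fintypeLinearCombination_injective
      exact_middle := by
        rw [LinearMap.exact_iff, Fintype.range_linearCombination, hspan]
      exact_right := hex
      minimal_f := fun i => constantCoeff_eq_zero_of_isHomogeneous
        (hf.pderiv_isHomogeneous i) (by omega)
      minimal_ρ := fun j i => constantCoeff_eq_zero_of_isHomogeneous
        (hρ.isHomogeneous j i) (by omega)
      -- A nonzero constant term in σ i j would make ρ j redundant.
      minimal_σ := fun i j => by
        by_contra h0
        have hmem : σ i ∈ LinearMap.ker A := hspan ▸ Submodule.subset_span ⟨i, rfl⟩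
        have h1 := mem_span_image_compl_of_relation (n := fun _ => r) hρ.isHomogeneous hmem h0
        exact hρ.minimal j ((span_image_compl_eq h1).trans hρ.span_eq) }

/-! ### The Hilbert function in large degrees and the degrees of the last syzygies. -/

theorem cast_choose_two_sub {k a : ℕ} (h : a ≤ k) :
    (((k - a + 2).choose 2 : ℕ) : ℚ) = ((k : ℚ) - a + 2) * (k - a + 1) / 2 := by
  rw [Nat.cast_choose_two]
  push_cast [Nat.cast_sub h]
  ring

/-- The Hilbert function of the Milnor algebra, computed from a resolution. -/
theorem IsMinimalMilnorResolution.hilbertFunction_eq {f : PolyS} {d m : ℕ} (hd : 1 ≤ d)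
    (hf : f.IsHomogeneous d) {dd : Fin m → ℕ} {e : Fin (m - 2) → ℕ} {ρ : Fin m → Fin 3 → PolyS}
    {σ : Fin (m - 2) → Fin m → PolyS} (h : IsMinimalMilnorResolution f d dd e ρ σ)
    {k : ℕ} (hk : d - 1 ≤ k) (hkd : ∀ j, d - 1 + dd j ≤ k) (hke : ∀ i, e i ≤ k) :
    (hilbertFunction (jacobianIdeal f) k : ℚ) =
      ((k + 2).choose 2 : ℕ) - 3 * ((k - (d - 1) + 2).choose 2 : ℕ) +
        ∑ j, ((k - (d - 1 + dd j) + 2).choose 2 : ℕ) - ∑ i, ((k - e i + 2).choose 2 : ℕ) := by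
  have h1 := hilbertFunction_add (range_jacobianMap f) (a := fun _ : Fin 3 => k - (d - 1))
    (k := k) fun i => Or.inr ⟨d - 1, Nat.sub_add_cancel hk, hf.pderiv⟩
  have h2 := finrank_gradedImage_add (a := fun j : Fin m => k - (d - 1 + dd j))
    (b := fun _ : Fin 3 => k - (d - 1)) (A := ρ)
    (fun j i => Or.inr ⟨dd j, by have := hkd j; grind, h.homogeneous_ρ j i⟩) h.exact_right
  have h3 := finrank_gradedImage_add (a := fun i : Fin (m - 2) => k - e i)
    (b := fun j : Fin m => k - (d - 1 + dd j)) (A := σ)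
    (fun i j => (h.homogeneous_σ i j).imp id fun ⟨n, hn, hn'⟩ =>
      ⟨n, by have := hkd j; have := hke i; grind, hn'⟩) h.exact_middle
  rw [finrank_gradedImage_of_injective _ h.injective] at h3
  have q1 := congrArg (Nat.cast : ℕ → ℚ) h1
  have q2 := congrArg (Nat.cast : ℕ → ℚ) h2
  have q3 := congrArg (Nat.cast : ℕ → ℚ) h3
  simp only [Finset.sum_const, Finset.card_univ, Fintype.card_fin, nsmul_eq_mul] at q2
  push_cast at q1 q2 q3 ⊢
  have q0 : (Module.finrank ℂ (gradedImage (fun _ : Fin 3 => k - (d - 1)) (jacobianMap f)) : ℚ) =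
    Module.finrank ℂ (gradedImage (fun _ : Fin 3 => k - (d - 1))
      (Fintype.linearCombination PolyS fun i => pderiv i f)) := rfl
  linear_combination q1 - q2 + q3 + q0

/-- Injectivity makes σ i nonzero. A nonzero entry of it is homogeneous and has no constant term, so
its degree n is positive. -/
theorem IsMinimalMilnorResolution.exists_degree {f : PolyS} {d m r : ℕ} (hd : 1 ≤ d)
    {e : Fin (m - 2) → ℕ} {ρ : Fin m → Fin 3 → PolyS}
    {σ : Fin (m - 2) → Fin m → PolyS}
    (h : IsMinimalMilnorResolution f d (fun _ => r) e ρ σ) (i : Fin (m - 2)) :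
    ∃ n, 1 ≤ n ∧ e i = d - 1 + r + n := by
  have hne : σ i ≠ 0 := by
    intro h0
    have h1 : (Pi.single i 1 : Fin (m - 2) → PolyS) = 0 := h.injective (by
      rw [Fintype.linearCombination_apply_single, h0, map_zero, smul_zero])
    simpa using congrFun h1 i
  obtain ⟨j, hj⟩ := Function.ne_iff.1 hne
  obtain ⟨n, hn, hn'⟩ := (h.homogeneous_σ i j).resolve_left hj
  refine ⟨n, Nat.one_le_iff_ne_zero.2 fun h0 => hj ?_, by omega⟩
  subst h0
  rw [← totalDegree_zero_iff_isHomogeneous, totalDegree_eq_zero_iff_eq_C] at hn'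
  have h2 := h.minimal_σ i j
  rw [constantCoeff_eq] at h2
  rw [hn', h2, map_zero]
  rfl

theorem slope_eq_zero_of_bounded {α β B : ℚ} {N : ℕ}
    (h : ∀ k : ℕ, N ≤ k → 0 ≤ α * k + β ∧ α * k + β ≤ B) : α = 0 := by
  by_contra hα
  obtain ⟨t, ht⟩ := exists_nat_gt (B / |α|)
  rw [div_lt_iff₀ (abs_pos.2 hα)] at ht
  have h1 := h N le_rfl
  have h2 := h (N + t) (Nat.le_add_right _ _)
  push_cast at h2
  have h3 : α * t ≤ B := by linarith
  have h4 : -(α * t) ≤ B := by linarith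
  rcases abs_cases α with ⟨h5, _⟩ | ⟨h5, _⟩ <;> rw [h5] at ht <;> linarith

/-- The degrees in a minimal resolution of a curve of type `(d, r, m)`, and the value of the
Hilbert function in large degrees. -/
theorem IsMinimalMilnorResolution.degrees {f : PolyS} {d m r : ℕ}
    (hf : IsReducedPlaneCurve d f) (hm : 2 ≤ m)
    {e : Fin (m - 2) → ℕ} {ρ : Fin m → Fin 3 → PolyS} {σ : Fin (m - 2) → Fin m → PolyS}
    (h : IsMinimalMilnorResolution f d (fun _ => r) e ρ σ) :
    ∃ n : Fin (m - 2) → ℕ, Monotone n ∧ (∀ i, 1 ≤ n i) ∧ (∀ i, e i = d - 1 + r + n i) ∧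
      (d : ℤ) + ∑ i, (n i : ℤ) = 2 * r + 1 ∧
      ∃ N, ∀ k ≥ N, (hilbertFunction (jacobianIdeal f) k : ℚ) =
        (2 - 3 * (3 - (d : ℚ)) * (2 - d) + 2 * (3 - (d : ℚ) - r) * (2 - d - r) +
          (∑ i, (n i : ℚ)) * (5 - 2 * d - 2 * r) - ∑ i, (n i : ℚ) ^ 2) / 2 := by
  have hd := hf.three_le
  choose n hn1 hn using h.exists_degree (by omega)
  -- Large enough for the bound (d - 1)² and for every shift d - 1, d - 1 + r and e_i, so that no
  -- subtraction of naturals truncates.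
  set N := 2 * (d - 1) + r + ∑ i, n i
  set α : ℚ := (d - 1) - 2 * r + ∑ i, (n i : ℚ)
  set β : ℚ := (2 - 3 * (3 - (d : ℚ)) * (2 - d) + 2 * (3 - (d : ℚ) - r) * (2 - d - r) +
    (∑ i, (n i : ℚ)) * (5 - 2 * d - 2 * r) - ∑ i, (n i : ℚ) ^ 2) / 2
  have hH : ∀ k ≥ N, (hilbertFunction (jacobianIdeal f) k : ℚ) = α * k + β := by
    intro k hk
    have hke : ∀ i, e i ≤ k := fun i => by
      have := Finset.single_le_sum (f := n) (fun _ _ => Nat.zero_le _) (Finset.mem_univ i)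
      rw [hn i]
      omega
    have h0 : (((k + 2).choose 2 : ℕ) : ℚ) = ((k : ℚ) + 2) * (k + 1) / 2 := by
      simpa using cast_choose_two_sub (Nat.zero_le k)
    have hsum : ∑ i, (((k - e i + 2).choose 2 : ℕ) : ℚ) =
        ((m - 2 : ℚ) * ((k - (d - 1 + r) + 2) * (k - (d - 1 + r) + 1)) -
          (∑ i, (n i : ℚ)) * (2 * (k - (d - 1 + r)) + 3) + ∑ i, (n i : ℚ) ^ 2) / 2 := by
      have hterm : ∀ i, (((k - e i + 2).choose 2 : ℕ) : ℚ) =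
          ((k - (d - 1 + r) + 2) * (k - (d - 1 + r) + 1) / 2 -
          (n i : ℚ) * ((2 * (k - (d - 1 + r)) + 3) / 2) + (n i : ℚ) ^ 2 / 2) := by
        intro i
        rw [cast_choose_two_sub (hke i), hn i]
        push_cast [Nat.cast_sub (show 1 ≤ d by omega)]
        ring
      rw [Finset.sum_congr rfl fun i _ => hterm i, Finset.sum_add_distrib,
        Finset.sum_sub_distrib, ← Finset.sum_mul, Finset.sum_const,
        ← Finset.sum_div]
      simp only [Finset.card_univ, Fintype.card_fin, nsmul_eq_mul]
      push_cast [Nat.cast_sub hm]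
      ring
    rw [h.hilbertFunction_eq (by omega) hf.isHomogeneous (by omega) (fun _ => by omega) hke,
      Nat.cast_sum, Nat.cast_sum, hsum, h0, cast_choose_two_sub (show d - 1 ≤ k by omega)]
    simp only [Finset.sum_const, Finset.card_univ, Fintype.card_fin, nsmul_eq_mul]
    rw [cast_choose_two_sub (show d - 1 + r ≤ k by omega)]
    push_cast [Nat.cast_sub (show 1 ≤ d by omega)]
    simp only [α, β]
    ring
  -- A function αk + β with values in [0, (d - 1)²] for all large k has no slope.
  have hα : α = 0 := slope_eq_zero_of_bounded (N := N) (B := (((d - 1) ^ 2 : ℕ) : ℚ))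
    (β := β) fun k hk => by
      rw [← hH k hk]
      exact ⟨Nat.cast_nonneg _, Nat.cast_le.2 (hilbertFunction_jacobianIdeal_le hf (by omega))⟩
  refine ⟨n, fun i j hij => ?_, hn1, hn, ?_, N, fun k hk => ?_⟩
  · have := h.monotone_e hij
    rw [hn, hn] at this
    omega
  · have h1 : (d : ℚ) + ∑ i, (n i : ℚ) = 2 * r + 1 := by
      simp only [α] at hα
      linear_combination hα
    exact_mod_cast h1
  · rw [hH k hk, hα, zero_mul, zero_add]

/-! ### The two possible sequences of degrees and the conclusion. -/

/-- Monotone sequences of `q` positive integers with sum `q + 2`. -/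
theorem monotone_sum_eq_add_two {q : ℕ} (hq : 2 ≤ q) {n : Fin q → ℕ} (hmono : Monotone n)
    (hpos : ∀ i, 1 ≤ n i) (hsum : ∑ i, n i = q + 2) :
    ((∀ j : Fin q, n j = if (j : ℕ) + 1 = q then 3 else 1) ∧ ∑ i, n i ^ 2 = q + 8) ∨
      ((∀ j : Fin q, n j = if (j : ℕ) + 1 = q ∨ (j : ℕ) + 1 = q - 1 then 2 else 1) ∧
        ∑ i, n i ^ 2 = q + 6) := by
  obtain ⟨t, rfl⟩ := Nat.exists_eq_add_of_le' hq
  have hsplit : ∀ g : Fin (t + 2) → ℕ, ∑ i, g i =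
      ∑ i : Fin t, g i.castSucc.castSucc + g (Fin.last t).castSucc + g (Fin.last (t + 1)) :=
    fun g => by rw [Fin.sum_univ_castSucc, Fin.sum_univ_castSucc]
  have hlast : n (Fin.last t).castSucc ≤ n (Fin.last (t + 1)) := hmono (Fin.le_last _)
  rw [hsplit] at hsum
  -- If an entry before the last two exceeds 1, the last two are at least 2 by monotonicity, and the
  -- sum is at least (t + 1) + 4 > t + 4.
  have hone : ∀ i : Fin t, n i.castSucc.castSucc = 1 := by
    intro i
    by_contra hi
    have h2 : 2 ≤ n i.castSucc.castSucc := by have := hpos i.castSucc.castSucc; omega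
    have h3 : n i.castSucc.castSucc ≤ n (Fin.last t).castSucc :=
      hmono (Fin.castSucc_le_castSucc_iff.2 (Fin.le_last _))
    have h4 : ∑ _i : Fin t, 1 < ∑ i : Fin t, n i.castSucc.castSucc :=
      Finset.sum_lt_sum (fun j _ => hpos _) ⟨i, Finset.mem_univ _, h2⟩
    simp at h4
    omega
  have hforall : ∀ P : Fin (t + 2) → Prop, (∀ i : Fin t, P i.castSucc.castSucc) →
      P (Fin.last t).castSucc → P (Fin.last (t + 1)) → ∀ j, P j := by
    intro P h1 h2 h3 j
    induction j using Fin.lastCases with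
    | last => exact h3
    | cast j =>
      induction j using Fin.lastCases with
      | last => exact h2
      | cast j => exact h1 j
  simp only [hone, Finset.sum_const, Finset.card_univ, Fintype.card_fin, smul_eq_mul,
    mul_one] at hsum
  have h1 := hpos (Fin.last t).castSucc
  have hcases : (n (Fin.last t).castSucc = 1 ∧ n (Fin.last (t + 1)) = 3) ∨
      (n (Fin.last t).castSucc = 2 ∧ n (Fin.last (t + 1)) = 2) := by omega
  rcases hcases with ⟨ha, hb⟩ | ⟨ha, hb⟩
  · refine Or.inl ⟨hforall _ (fun i => ?_) ?_ ?_, ?_⟩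
    · rw [hone, if_neg]
      have := i.2
      simp; omega
    · rw [ha, if_neg]; simp
    · rw [hb, if_pos]; simp
    · rw [hsplit]; simp [hone, ha, hb]
  · refine Or.inr ⟨hforall _ (fun i => ?_) ?_ ?_, ?_⟩
    · rw [hone, if_neg]
      have := i.2
      simp; omega
    · rw [ha, if_pos]; simp
    · rw [hb, if_pos]; simp
    · rw [hsplit]; simp [hone, ha, hb]

theorem mainTheorem4 (d r m : ℕ) (f : PolyS) (hC : IsCurveOfType d r m f)
    (hm : 3 < m) (hΔ : deltaM d r m = 2) :
    ∃ τ : ℕ, HasTotalTjurinaNumber f τ ∧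
      (∃ (e : Fin (m - 2) → ℕ) (ρ : Fin m → Fin 3 → PolyS) (σ : Fin (m - 2) → Fin m → PolyS),
        IsMinimalMilnorResolution f d (fun _ => r) e ρ σ) ∧
      ∀ (e : Fin (m - 2) → ℕ) (ρ : Fin m → Fin 3 → PolyS) (σ : Fin (m - 2) → Fin m → PolyS),
        IsMinimalMilnorResolution f d (fun _ => r) e ρ σ →
        Xor
          ((∀ j : Fin (m - 2), resolutionEpsilon d (fun _ : Fin m => r) e j =
              if (j : ℕ) + 1 = m - 2 then 3 else 1) ∧
            (τ : ℚ) = (d : ℚ) * ((d : ℚ) - 1) / 2 - 3 + (r : ℚ) * ((d : ℚ) - r - 2))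
          ((∀ j : Fin (m - 2), resolutionEpsilon d (fun _ : Fin m => r) e j =
              if (j : ℕ) + 1 = m - 2 ∨ (j : ℕ) + 1 = m - 3 then 2 else 1) ∧
            (τ : ℚ) = (d : ℚ) * ((d : ℚ) - 1) / 2 - 2 + (r : ℚ) * ((d : ℚ) - r - 2)) := by
  obtain ⟨hf, ρ₀, hρ₀⟩ := hC
  have hd := hf.three_le
  rw [deltaM] at hΔ
  -- Here r ≥ 1 because 2r = m + d - 1 with m > 3 and d ≥ 3.
  obtain ⟨e₀, σ₀, h₀⟩ := exists_isMinimalMilnorResolution hf (by omega) hρ₀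
  obtain ⟨n₀, -, -, -, -, N₀, hN₀⟩ := h₀.degrees hf (by omega)
  have hτ : ∀ k ≥ N₀, hilbertFunction (jacobianIdeal f) k =
      hilbertFunction (jacobianIdeal f) N₀ := fun k hk => by
    have h1 := (hN₀ k hk).trans (hN₀ N₀ le_rfl).symm
    exact_mod_cast h1
  refine ⟨hilbertFunction (jacobianIdeal f) N₀, Filter.eventually_atTop.2 ⟨N₀, hτ⟩,
    ⟨e₀, ρ₀, σ₀, h₀⟩, fun e ρ σ h => ?_⟩
  obtain ⟨n, hmono, hpos, hn, hsum, N, hN⟩ := h.degrees hf (by omega)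
  -- The value τ was read off from one resolution; comparing in a degree beyond both thresholds
  -- expresses it through the given one.
  have hHτ := hN (max N N₀) (le_max_left _ _)
  rw [hτ _ (le_max_right _ _)] at hHτ
  have hε : ∀ j, resolutionEpsilon d (fun _ : Fin m => r) e j = n j := fun j => by
    rw [resolutionEpsilon, hn j]
    push_cast [Nat.cast_sub (show 1 ≤ d by omega)]
    ring
  have hsumN : ∑ i, n i = m - 2 + 2 := by
    have h1 : ((∑ i, n i : ℕ) : ℤ) = m := by push_cast; linarith
    have h2 : ∑ i, n i = m := by exact_mod_cast h1
    omega
  have hsumQ : ∑ i, (n i : ℚ) = m := by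
    have h1 : ((∑ i, n i : ℕ) : ℚ) = ((m - 2 + 2 : ℕ) : ℚ) := by rw [hsumN]
    rw [Nat.sub_add_cancel (by omega)] at h1
    exact_mod_cast h1
  have hmQ : (m : ℚ) = 2 * r - d + 1 := by
    have h1 : (m : ℤ) = 2 * r - d + 1 := by linarith
    exact_mod_cast h1
  have hcast : ∀ c : ℕ, ∑ i, n i ^ 2 = m - 2 + c → ∑ i, (n i : ℚ) ^ 2 = m - 2 + c := by
    intro c hc
    have h1 : ((∑ i, n i ^ 2 : ℕ) : ℚ) = ((m - 2 + c : ℕ) : ℚ) := by rw [hc]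
    push_cast [Nat.cast_sub (show 2 ≤ m by omega)] at h1
    exact h1
  rw [hsumQ] at hHτ
  have hlast : m - 3 < m - 2 := by omega
  simp only [hε]
  rcases monotone_sum_eq_add_two (by omega) hmono hpos hsumN with ⟨hj, hsq⟩ | ⟨hj, hsq⟩
  · refine Or.inl ⟨⟨fun j => ?_, ?_⟩, fun h2 => ?_⟩
    · rw [hj j]; push_cast; rfl
    · rw [hHτ, hcast _ hsq, hmQ]; push_cast; ring
    · have h3 := h2.1 ⟨m - 3, hlast⟩
      rw [hj, if_pos (by simp only; omega), if_pos (by simp only; omega)] at h3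
      norm_num at h3
  · refine Or.inr ⟨⟨fun j => ?_, ?_⟩, fun h2 => ?_⟩
    · rw [hj j, Nat.sub_sub]; push_cast; rfl
    · rw [hHτ, hcast _ hsq, hmQ]; push_cast; ring
    · have h3 := h2.1 ⟨m - 3, hlast⟩
      rw [hj, if_pos (by simp only; omega), if_pos (by simp only; omega)] at h3
      norm_num at h3
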